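/- Let $n\ge 2$, let $\Omega\subset\mathbb{R}^n$ be open and convex, let $\tau_2>\tau_1>0$, and let $g$ be a (Lebesgue measurable) function on $\Omega$ with $\tau_1<g(x)<\tau_2$ for all $x\in\Omega$. For a convex function $v$ on $\Omega$ and $x\in\Omega$ let $$\partial v(x)=\{z\in\mathbb{R}^n : v(y)\ge v(x)+\langle z,y-x\rangle \text{ for all } y\in\Omega\},$$ and let $\mu_v(\omega)=\mathcal{H}^n\big(\bigcup_{x\in\omega}\partial v(x)\big)$, for Borel sets $\omega\subset\Omega$, be the Monge-Ampère measure of $v$, where $\mathcal{H}^n$ is Lebesgue measure. Let $p<1$, and let $v$ be a non-negative convex function on $\Omega$ that solves $$v^{1-p}\det\nabla^2 v=g\quad\text{in }\Omega$$ in the sense of measure (in the Alexandrov sense), that is, $v^{1-p}\,d\mu_v=g\,d\mathcal{H}^n$ as Borel measures on $\Omega$. Put $S=\{x\in\Omega : v(x)=0\}$. Assume that $S$ is non-empty and compact, that $\mu_v(S)=0$, and that $v$ is locally strictly convex on $\Omega\setminus S$, i.e. every point of $\Omega\setminus S$ has a ball around it, contained in $\Omega\setminus S$, on which $v$ is strictly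 convex. Then $S$ consists of a single point. -/

import Mathlib

open MeasureTheory Set

/-- The subgradient `∂v(x)` of `v` at `x`, relative to the domain `Ω`. -/
def subgradient {n : ℕ} (Ω : Set (EuclideanSpace ℝ (Fin n))) (v : EuclideanSpace ℝ (Fin n) → ℝ)
    (x : EuclideanSpace ℝ (Fin n)) : Set (EuclideanSpace ℝ (Fin n)) :=
  {z | ∀ y ∈ Ω, v y ≥ v x + inner ℝ z (y - x)}

/-- The image `N_v(ω)` of `ω ∩ Ω` under the (multivalued) gradient map of `v`. -/
def gradientImage {n : ℕ} (Ω : Set (EuclideanSpace ℝ (Fin n))) (v : EuclideanSpace ℝ (Fin n) → ℝ)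
    (ω : Set (EuclideanSpace ℝ (Fin n))) : Set (EuclideanSpace ℝ (Fin n)) :=
  ⋃ x ∈ ω ∩ Ω, subgradient Ω v x

/-- The set function `ω ↦ ℋⁿ(N_v(ω))`, on all sets `ω`. -/
noncomputable def mongeAmpereOuterMeasure {n : ℕ} (Ω : Set (EuclideanSpace ℝ (Fin n)))
    (v : EuclideanSpace ℝ (Fin n) → ℝ) : OuterMeasure (EuclideanSpace ℝ (Fin n)) where
  measureOf ω := volume (gradientImage Ω v ω)
  empty := by simp [gradientImage]
  mono h := measure_mono (biUnion_subset_biUnion_left (inter_subset_inter_left Ω h))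
  iUnion_nat s _ := by
    refine (measure_mono ?_).trans (measure_iUnion_le fun i => gradientImage Ω v (s i))
    intro z hz
    simp only [gradientImage, mem_iUnion, mem_inter_iff, exists_prop] at hz ⊢
    obtain ⟨x, ⟨⟨i, hi⟩, hx⟩, hz⟩ := hz
    exact ⟨i, x, ⟨hi, hx⟩, hz⟩

theorem isClosed_gradientImage_of_isCompact {n : ℕ} {Ω K : Set (EuclideanSpace ℝ (Fin n))}
    {v : EuclideanSpace ℝ (Fin n) → ℝ} (hv : ContinuousOn v Ω) (hK : IsCompact K) (hKΩ : K ⊆ Ω) :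
    IsClosed (gradientImage Ω v K) := by
  have : CompactSpace K := isCompact_iff_compactSpace.mp hK
  have hvK : Continuous fun q : K × EuclideanSpace ℝ (Fin n) => v q.1 :=
    (continuousOn_iff_continuous_domRestrict.mp (hv.mono hKΩ)).comp continuous_fst
  have hC : IsClosed {q : K × EuclideanSpace ℝ (Fin n) |
      ∀ y ∈ Ω, v q.1 + inner ℝ q.2 (y - (q.1 : EuclideanSpace ℝ (Fin n))) ≤ v y} := by
    simp only [ofPred_forall]
    refine isClosed_iInter fun y => isClosed_iInter fun _ => isClosed_le (hvK.add ?_)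
      continuous_const
    fun_prop
  convert isClosedMap_snd_of_compactSpace _ hC using 1
  ext z
  simp only [gradientImage, subgradient, mem_iUnion, mem_inter_iff, exists_prop, mem_image,
    mem_ofPred_eq, Prod.exists, exists_eq_right, Subtype.exists, ge_iff_le]
  exact ⟨fun ⟨x, ⟨hx, _⟩, h⟩ => ⟨x, hx, h⟩, fun ⟨x, hx, h⟩ => ⟨x, ⟨hx, hKΩ hx⟩, h⟩⟩

theorem exists_compact_exhaustion {n : ℕ} {Ω : Set (EuclideanSpace ℝ (Fin n))} (hΩ : IsOpen Ω) :
    ∃ K : ℕ → Set (EuclideanSpace ℝ (Fin n)),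
      Monotone K ∧ (∀ i, IsCompact (K i)) ∧ ⋃ i, K i = Ω := by
  have : LocallyCompactSpace Ω := hΩ.locallyCompactSpace
  let K : CompactExhaustion Ω := default
  refine ⟨fun i => (↑) '' K i, fun i j hij => image_mono (K.subset hij),
    fun i => (K.isCompact i).image continuous_subtype_val, ?_⟩
  rw [← image_iUnion, K.iUnion_eq, image_univ, Subtype.range_coe]

theorem measurableSet_gradientImage_of_isClosed {n : ℕ} {Ω F : Set (EuclideanSpace ℝ (Fin n))}
    {v : EuclideanSpace ℝ (Fin n) → ℝ} (hΩ : IsOpen Ω) (hv : ContinuousOn v Ω)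
    (hF : IsClosed F) : MeasurableSet (gradientImage Ω v F) := by
  obtain ⟨K, -, hK, hKΩ⟩ := exists_compact_exhaustion hΩ
  have h : gradientImage Ω v F = ⋃ i, gradientImage Ω v (K i ∩ F) := by
    ext z
    simp only [gradientImage, mem_iUnion, mem_inter_iff, exists_prop]
    constructor
    · rintro ⟨x, ⟨hxF, hx⟩, hz⟩
      obtain ⟨i, hi⟩ := mem_iUnion.mp (hKΩ.symm ▸ hx)
      exact ⟨i, x, ⟨⟨hi, hxF⟩, hx⟩, hz⟩
    · rintro ⟨i, x, ⟨⟨_, hxF⟩, hx⟩, hz⟩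
      exact ⟨x, ⟨hxF, hx⟩, hz⟩
  rw [h]
  exact MeasurableSet.iUnion fun i => (isClosed_gradientImage_of_isCompact hv
    ((hK i).inter_right hF)
    (inter_subset_left.trans (hKΩ ▸ subset_iUnion K i))).measurableSet

theorem volume_subgradient_overlap_compact {n : ℕ} {Ω K : Set (EuclideanSpace ℝ (Fin n))}
    {v : EuclideanSpace ℝ (Fin n) → ℝ} (hv : ContinuousOn v Ω) (hK : IsCompact K) (hKΩ : K ⊆ Ω) :
    volume {z | ∃ x ∈ K, ∃ y ∈ K, x ≠ y ∧ z ∈ subgradient Ω v x ∧ z ∈ subgradient Ω v y} = 0 := by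
  obtain ⟨R, hR⟩ := hK.isBounded.exists_norm_le
  let u : EuclideanSpace ℝ (Fin n) → ℝ := fun z => sSup ((fun x => inner ℝ z x - v x) '' K)
  have hbdd : ∀ z, BddAbove ((fun x => inner ℝ z x - v x) '' K) := fun z =>
    (hK.image_of_continuousOn ((Continuous.continuousOn (by fun_prop)).sub
      (hv.mono hKΩ))).bddAbove
  have hle : ∀ z, ∀ x ∈ K, inner ℝ z x - v x ≤ u z := fun z x hx =>
    le_csSup (hbdd z) ⟨x, hx, rfl⟩
  have hLip : LipschitzWith R.toNNReal u := by
    refine LipschitzWith.of_le_add_mul _ fun z w => ?_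
    rcases K.eq_empty_or_nonempty with rfl | hne
    · simp only [u, image_empty, Real.sSup_empty, zero_add]; positivity
    · refine csSup_le (hne.image _) ?_
      rintro _ ⟨x, hx, rfl⟩
      have h1 : inner ℝ (z - w) x ≤ ‖z - w‖ * ‖x‖ := real_inner_le_norm _ _
      have h2 : ‖z - w‖ * ‖x‖ ≤ ‖z - w‖ * R :=
        mul_le_mul_of_nonneg_left (hR x hx) (norm_nonneg _)
      have h3 : R ≤ R.toNNReal := Real.le_coe_toNNReal R
      have h4 := mul_le_mul_of_nonneg_left h3 (norm_nonneg (z - w))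
      have h5 := hle w x hx
      rw [inner_sub_left] at h1
      rw [dist_eq_norm]
      simp only
      nlinarith
  have hgrad : ∀ z, DifferentiableAt ℝ u z → ∀ x ∈ K, z ∈ subgradient Ω v x →
      fderiv ℝ u z = innerSL ℝ x := by
    intro z hz x hx hzx
    have hval : u z = inner ℝ z x - v x := by
      refine le_antisymm (csSup_le ⟨_, x, hx, rfl⟩ ?_) (hle z x hx)
      rintro _ ⟨y, hy, rfl⟩
      have := hzx y (hKΩ hy)
      rw [inner_sub_right] at this
      simp only
      linarith
    have hmin : IsLocalMin (fun w => u w - innerSL ℝ x w) z := by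
      refine Filter.Eventually.of_forall fun w => ?_
      have := hle w x hx
      simp only [innerSL_apply_apply, real_inner_comm w x, real_inner_comm z x, hval]
      linarith
    have hd := hmin.fderiv_eq_zero
    rw [fderiv_fun_sub hz (innerSL ℝ x).differentiableAt, ContinuousLinearMap.fderiv] at hd
    exact sub_eq_zero.mp hd
  refine measure_mono_null ?_ hLip.ae_differentiableAt
  rintro z ⟨x, hx, y, hy, hxy, hzx, hzy⟩ hz
  have h := (hgrad z hz x hx hzx).symm.trans (hgrad z hz y hy hzy)
  exact hxy (by simpa using h)

theorem volume_subgradient_overlap {n : ℕ} {Ω : Set (EuclideanSpace ℝ (Fin n))}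
    {v : EuclideanSpace ℝ (Fin n) → ℝ} (hΩ : IsOpen Ω) (hv : ContinuousOn v Ω) :
    volume {z | ∃ x ∈ Ω, ∃ y ∈ Ω, x ≠ y ∧ z ∈ subgradient Ω v x ∧ z ∈ subgradient Ω v y} = 0 := by
  obtain ⟨K, hmono, hK, hKΩ⟩ := exists_compact_exhaustion hΩ
  refine measure_mono_null ?_ (measure_iUnion_null fun i =>
    volume_subgradient_overlap_compact hv (hK i) (hKΩ ▸ subset_iUnion K i))
  rintro z ⟨x, hx, y, hy, h⟩
  obtain ⟨i, hi⟩ := mem_iUnion.mp (hKΩ.symm ▸ hx)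
  obtain ⟨j, hj⟩ := mem_iUnion.mp (hKΩ.symm ▸ hy)
  exact mem_iUnion.mpr ⟨max i j, x, hmono (le_max_left i j) hi, y,
    hmono (le_max_right i j) hj, h⟩

/-- Borel sets are Carathéodory measurable for `ω ↦ ℋⁿ(N_v(ω))`, so that this set function
restricts to a Borel measure. -/
theorem borel_le_caratheodory_mongeAmpere {n : ℕ} {Ω : Set (EuclideanSpace ℝ (Fin n))}
    {v : EuclideanSpace ℝ (Fin n) → ℝ} (hΩ : IsOpen Ω) (hv : ConvexOn ℝ Ω v) :
    (inferInstance : MeasurableSpace (EuclideanSpace ℝ (Fin n))) ≤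
      (mongeAmpereOuterMeasure Ω v).caratheodory := by
  have hc : ContinuousOn v Ω := hv.continuousOn hΩ
  rw [BorelSpace.measurable_eq (α := EuclideanSpace ℝ (Fin n)), borel_eq_generateFrom_isClosed]
  refine MeasurableSpace.generateFrom_le fun F hF => ?_
  rw [OuterMeasure.isCaratheodory_iff_le]
  intro T
  change volume (gradientImage Ω v (T ∩ F)) + volume (gradientImage Ω v (T \ F)) ≤
    volume (gradientImage Ω v T)
  rw [← measure_inter_add_sdiff (gradientImage Ω v T)
    (measurableSet_gradientImage_of_isClosed hΩ hc hF)]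
  refine add_le_add (measure_mono ?_) ?_
  · intro z hz
    simp only [gradientImage, mem_iUnion, mem_inter_iff, exists_prop] at hz ⊢
    obtain ⟨x, ⟨⟨hxT, hxF⟩, hx⟩, hz⟩ := hz
    exact ⟨⟨x, ⟨hxT, hx⟩, hz⟩, ⟨x, ⟨hxF, hx⟩, hz⟩⟩
  · refine (measure_mono (t := (gradientImage Ω v T \ gradientImage Ω v F) ∪
      {z | ∃ x ∈ Ω, ∃ y ∈ Ω, x ≠ y ∧ z ∈ subgradient Ω v x ∧ z ∈ subgradient Ω v y}) ?_).trans
      ((measure_union_le _ _).trans_eq ?_)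
    · intro z hz
      simp only [gradientImage, mem_iUnion, mem_inter_iff, mem_sdiff, exists_prop, mem_union,
        mem_ofPred_eq] at hz ⊢
      obtain ⟨x, ⟨⟨hxT, hxF⟩, hx⟩, hz⟩ := hz
      by_cases h : ∃ y, (y ∈ F ∧ y ∈ Ω) ∧ z ∈ subgradient Ω v y
      · obtain ⟨y, ⟨hyF, hy⟩, hzy⟩ := h
        exact Or.inr ⟨x, hx, y, hy, fun e => hxF (e ▸ hyF), hz, hzy⟩
      · exact Or.inl ⟨⟨x, ⟨hxT, hx⟩, hz⟩, h⟩
    · rw [volume_subgradient_overlap hΩ hc, add_zero]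

/-- The Monge–Ampère measure `μ_v` of a convex function `v` on an open convex set `Ω`, as a Borel
measure on `ℝⁿ` that vanishes outside `Ω`. -/
noncomputable def mongeAmpereMeasure {n : ℕ} {Ω : Set (EuclideanSpace ℝ (Fin n))}
    {v : EuclideanSpace ℝ (Fin n) → ℝ} (hΩ : IsOpen Ω) (hv : ConvexOn ℝ Ω v) :
    Measure (EuclideanSpace ℝ (Fin n)) :=
  (mongeAmpereOuterMeasure Ω v).toMeasure (borel_le_caratheodory_mongeAmpere hΩ hv)

/-- `μ_v(ω) = ℋⁿ(N_v(ω))` for every Borel set `ω`. -/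
theorem mongeAmpereMeasure_apply {n : ℕ} {Ω : Set (EuclideanSpace ℝ (Fin n))}
    {v : EuclideanSpace ℝ (Fin n) → ℝ} (hΩ : IsOpen Ω) (hv : ConvexOn ℝ Ω v)
    {ω : Set (EuclideanSpace ℝ (Fin n))} (hω : MeasurableSet ω) :
    mongeAmpereMeasure hΩ hv ω = volume (gradientImage Ω v ω) :=
  toMeasure_apply _ _ hω

/-- `v` solves `v^{1-p} det ∇²v = g` in `Ω` in the sense of measure (in the Alexandrov sense):
`v^{1-p} dμ_v = g dℋⁿ` on `Ω`. -/
def IsAlexandrovSolution {n : ℕ} {Ω : Set (EuclideanSpace ℝ (Fin n))}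
    {v : EuclideanSpace ℝ (Fin n) → ℝ} (hΩ : IsOpen Ω) (hv : ConvexOn ℝ Ω v) (p : ℝ)
    (g : EuclideanSpace ℝ (Fin n) → ℝ) : Prop :=
  (mongeAmpereMeasure hΩ hv).withDensity (fun x => ENNReal.ofReal (v x ^ (1 - p))) =
    (volume.restrict Ω).withDensity (fun x => ENNReal.ofReal (g x))

/-- `v` is locally strictly convex on `U`: every point of `U` has a ball around it, contained
in `U`, on which `v` is strictly convex. -/
def LocallyStrictConvexOn {n : ℕ} (U : Set (EuclideanSpace ℝ (Fin n)))
    (v : EuclideanSpace ℝ (Fin n) → ℝ) : Prop :=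
  ∀ x ∈ U, ∃ r > 0, Metric.ball x r ⊆ U ∧ StrictConvexOn ℝ (Metric.ball x r) v

/-!
Suppose that `S = {v = 0}` has two points `u ≠ b`. Put `e = u - b`, let `a` maximize `⟪e, ·⟫` on
`S`, and let `d = ⟪e, a - b⟫ > 0`. For small `ε` consider the section
`Z = {v < ε ⟪e, x - b⟫}`, which contains the half-open segment `[a, b)`. As `ε → 0`, the sections
shrink to a part of `S`, so that `⟪e, x - a⟫ ≤ d / (4 N)` on `Z` for any prescribed `N`
(`exists_closure_cutSection_subset`): the point `a` is close to the boundary of `Z`, although the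
height `ε d` of the cutting plane above `v` at `a` is comparable to the maximal height.

This contradicts two Alexandrov-type estimates. Let `z` be the midpoint of `a` and `b`, which lies
in `S`, and write `(Z - x)°` for the polar of `Z` at `x`.

* The cone over `Z` with vertex at `a` gives `μ_v(Z) ≥ (ε d)ⁿ |(Z - a)°|`
  (`image_polarAt_subset_gradientImage`).
* The slopes of `v` over the half-size copy `Z'` of `Z` centred at `z` are controlled:
  `μ_v(Z') ≤ (4 ε d)ⁿ |(Z - z)°|` (`gradientImage_half_subset`).
* As `μ_v(S) = 0`, the measure `μ_v` has the density `g v^{p-1}`. Because `p < 1` and `v` decreases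
  when points are moved towards `z`, it follows that `μ_v(Z) ≤ 2ⁿ (τ₂ / τ₁) μ_v(Z')`
  (`IsAlexandrovSolution.mongeAmpereMeasure_le_half`).
* As `a` is close to the boundary of `Z` in the direction `e`, the polar `(Z - a)°` contains `N`
  disjoint translates of `(Z - z)° / 8` (`natCast_mul_addHaar_polarAt_le`).

Together these bound `N` in terms of `n`, `τ₁` and `τ₂` only, whereas `N` was arbitrary. Working with
polars at two points of the same section avoids any normalization by John ellipsoids.
-/

/-! ### Polar sets -/

/-- The polar of `Z` with respect to the point `a`, i.e. the one-sided polar of `Z - a`. -/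
def polarAt {F : Type*} [NormedAddCommGroup F] [InnerProductSpace ℝ F] (Z : Set F) (a : F) :
    Set F :=
  {q | ∀ x ∈ Z, inner ℝ q (x - a) ≤ 1}

section Polar

variable {F : Type*} [NormedAddCommGroup F] [InnerProductSpace ℝ F]

theorem isClosed_polarAt (Z : Set F) (a : F) : IsClosed (polarAt Z a) := by
  simp only [polarAt, ofPred_forall]
  exact isClosed_iInter fun x => isClosed_iInter fun _ => isClosed_le (by fun_prop)
    continuous_const

theorem isBounded_polarAt {Z : Set F} {a : F} (hZ : IsOpen Z) (ha : a ∈ Z) :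
    Bornology.IsBounded (polarAt Z a) := by
  obtain ⟨r, hr, hball⟩ := Metric.isOpen_iff.mp hZ a ha
  refine isBounded_iff_forall_norm_le.mpr ⟨2 / r, fun q hq => ?_⟩
  rcases eq_or_ne q 0 with rfl | hq0
  · simp only [norm_zero]; positivity
  have hn : 0 < ‖q‖ := norm_pos_iff.mpr hq0
  have hmem : a + (r / 2 / ‖q‖) • q ∈ Z := by
    apply hball
    rw [Metric.mem_ball, dist_eq_norm, add_sub_cancel_left, norm_smul, Real.norm_of_nonneg
      (by positivity), div_mul_cancel₀ _ hn.ne']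
    linarith
  have h := hq _ hmem
  rw [add_sub_cancel_left, inner_smul_right, real_inner_self_eq_norm_sq] at h
  rw [le_div_iff₀ hr]
  have : r / 2 / ‖q‖ * ‖q‖ ^ 2 = ‖q‖ * r / 2 := by field_simp
  linarith

theorem polarAt_mem_nhds_zero {Z : Set F} (hZ : Bornology.IsBounded Z) (a : F) :
    polarAt Z a ∈ nhds 0 := by
  obtain ⟨R, hR⟩ := isBounded_iff_forall_norm_le.mp hZ
  rcases Z.eq_empty_or_nonempty with rfl | ⟨x₀, hx₀⟩
  · simp [polarAt]
  have hR0 : 0 ≤ R := (norm_nonneg _).trans (hR _ hx₀)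
  have hp : 0 < R + ‖a‖ + 1 := by positivity
  refine Filter.mem_of_superset (Metric.ball_mem_nhds 0 (inv_pos.mpr hp)) fun q hq x hx => ?_
  rw [mem_ball_zero_iff] at hq
  calc inner ℝ q (x - a) ≤ ‖q‖ * ‖x - a‖ := real_inner_le_norm _ _
    _ ≤ (R + ‖a‖ + 1)⁻¹ * (R + ‖a‖ + 1) := by
        refine mul_le_mul hq.le ?_ (norm_nonneg _) (inv_pos.mpr hp).le
        linarith [norm_sub_le x a, hR x hx]
    _ = 1 := inv_mul_cancel₀ hp.ne'

variable [FiniteDimensional ℝ F] [MeasurableSpace F] [BorelSpace F]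

theorem addHaar_image_add_smul (μ : Measure F) [μ.IsAddHaarMeasure] (ξ : F) {c : ℝ}
    (hc : 0 ≤ c) (A : Set F) :
    μ ((fun q => ξ + c • q) '' A) = ENNReal.ofReal (c ^ Module.finrank ℝ F) * μ A := by
  have : (fun q => ξ + c • q) '' A = (fun q => ξ + q) '' ((fun q => c • q) '' A) := by
    rw [image_image]
  rw [this, image_add_left, measure_preimage_add, image_smul, Measure.addHaar_smul,
    abs_of_nonneg (by positivity)]

/-- If `Z` contains the half-open segment `[a, b)` and lies in a half-space whose bounding
hyperplane is close to `a`, then the polar of `Z` at `a` is much larger than the polar at the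
midpoint `z` of `[a, b]`. The functional `⟪·, a - b⟫` takes values in `[-4, 2]` on the polar `L` at
`z`, and the polar at `a` contains `L / 8` and a long segment in the direction `e`, hence `N`
disjoint translates of `L / 8`. -/
theorem natCast_mul_addHaar_polarAt_le (μ : Measure F) [μ.IsAddHaarMeasure] {Z : Set F}
    {a b e : F} {N : ℕ} (hN : 0 < N) (hZ : IsOpen Z) (hab : 0 < inner ℝ e (a - b))
    (hseg : ∀ t ∈ Ico (0 : ℝ) 1, a + t • (b - a) ∈ Z)
    (hcut : ∀ x ∈ Z, inner ℝ e (x - a) ≤ inner ℝ e (a - b) / (4 * N)) :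
    N * (ENNReal.ofReal ((1 / 8) ^ Module.finrank ℝ F) * μ (polarAt Z ((2⁻¹ : ℝ) • (a + b)))) ≤
      μ (polarAt Z a) := by
  set d := inner ℝ e (a - b) with hd
  set L := polarAt Z ((2⁻¹ : ℝ) • (a + b)) with hL
  have hN' : (0 : ℝ) < N := by exact_mod_cast hN
  have hup : ∀ q ∈ L, inner ℝ q (a - b) ≤ 2 := by
    intro q hq
    have h := hq (a + (0 : ℝ) • (b - a)) (hseg 0 (by simp))
    have e1 : a + (0 : ℝ) • (b - a) - (2⁻¹ : ℝ) • (a + b) = (2⁻¹ : ℝ) • (a - b) := by module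
    rw [e1, inner_smul_right] at h
    linarith
  -- `b` itself need not lie in `Z`, so an inner point of the segment is used
  have hlow : ∀ q ∈ L, -4 ≤ inner ℝ q (a - b) := by
    intro q hq
    have h := hq _ (hseg (3 / 4) (by constructor <;> norm_num))
    have e1 : a + (3 / 4 : ℝ) • (b - a) - (2⁻¹ : ℝ) • (a + b) = (-4⁻¹ : ℝ) • (a - b) := by module
    rw [e1, inner_smul_right] at h
    linarith
  let T : ℕ → Set F := fun k => (fun q => (2 * k / d) • e + (1 / 8 : ℝ) • q) '' L
  have hT : ∀ k < N, T k ⊆ polarAt Z a := by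
    rintro k hk _ ⟨q, hq, rfl⟩ x hx
    have hk' : (k : ℝ) ≤ N := by exact_mod_cast hk.le
    have h1 := hq x hx
    have e1 : x - (2⁻¹ : ℝ) • (a + b) = (x - a) + (1 / 2 : ℝ) • (a - b) := by module
    rw [e1, inner_add_right, inner_smul_right] at h1
    have h2 := hlow q hq
    rw [inner_add_left, inner_smul_left, inner_smul_left]
    simp only [conj_trivial]
    have h3 : 2 * k / d * inner ℝ e (x - a) ≤ 2 * k / d * (d / (4 * N)) :=
      mul_le_mul_of_nonneg_left (hcut x hx) (by positivity)
    have h4 : 2 * k / d * (d / (4 * N)) = 1 / 2 * (k / N) := by field_simp; ring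
    have h5 : (k : ℝ) / N ≤ 1 := (div_le_one hN').mpr hk'
    linarith
  have hval : ∀ k, ∀ w ∈ T k, |inner ℝ w (a - b) - 2 * k| ≤ 1 / 2 := by
    rintro k _ ⟨q, hq, rfl⟩
    rw [inner_add_left, inner_smul_left, inner_smul_left]
    simp only [conj_trivial]
    rw [← hd, div_mul_cancel₀ _ hab.ne', abs_le]
    constructor <;> linarith [hup q hq, hlow q hq]
  have hdisj : (↑(Finset.range N) : Set ℕ).PairwiseDisjoint T := by
    intro j _ k _ hjk
    refine disjoint_left.mpr fun w hwj hwk => hjk ?_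
    have h1 := abs_le.mp (hval j w hwj)
    have h2 := abs_le.mp (hval k w hwk)
    have h3 : (j : ℝ) < k + 1 := by linarith
    have h4 : (k : ℝ) < j + 1 := by linarith
    have h3' : j < k + 1 := by exact_mod_cast h3
    have h4' : k < j + 1 := by exact_mod_cast h4
    omega
  have hLc : IsCompact L := by
    refine Metric.isCompact_of_isClosed_isBounded (isClosed_polarAt Z _) (isBounded_polarAt hZ ?_)
    convert hseg (1 / 2) (by constructor <;> norm_num) using 1
    module
  have hmeas : ∀ k ∈ Finset.range N, MeasurableSet (T k) := fun k _ =>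
    (hLc.image (by fun_prop)).measurableSet
  calc _ = ∑ k ∈ Finset.range N, μ (T k) := by
        simp only [T, addHaar_image_add_smul μ _ (show (0 : ℝ) ≤ 1 / 8 by norm_num),
          Finset.sum_const, Finset.card_range, nsmul_eq_mul]
    _ = μ (⋃ k ∈ Finset.range N, T k) := (measure_biUnion_finset hdisj hmeas).symm
    _ ≤ μ (polarAt Z a) := measure_mono (iUnion₂_subset fun k hk => hT k (Finset.mem_range.mp hk))

end Polar

/-! ### Gradient images of sections -/

section Section

variable {n : ℕ} {Ω : Set (EuclideanSpace ℝ (Fin n))} {v : EuclideanSpace ℝ (Fin n) → ℝ}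

/-- The section cut from the graph of `v` by the affine function `x ↦ ⟪ξ, x⟫ + c`. -/
def cutSection (Ω : Set (EuclideanSpace ℝ (Fin n))) (v : EuclideanSpace ℝ (Fin n) → ℝ)
    (ξ : EuclideanSpace ℝ (Fin n)) (c : ℝ) : Set (EuclideanSpace ℝ (Fin n)) :=
  {x ∈ Ω | v x < inner ℝ ξ x + c}

theorem isOpen_cutSection (hΩ : IsOpen Ω) (hv : ContinuousOn v Ω)
    (ξ : EuclideanSpace ℝ (Fin n)) (c : ℝ) : IsOpen (cutSection Ω v ξ c) := by
  have h : cutSection Ω v ξ c = Ω ∩ (fun x => v x - (inner ℝ ξ x + c)) ⁻¹' Iio 0 := by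
    ext x
    simp [cutSection, sub_neg]
  rw [h]
  exact (hv.sub (Continuous.continuousOn (by fun_prop))).isOpen_inter_preimage hΩ isOpen_Iio

theorem convex_cutSection (hv : ConvexOn ℝ Ω v) (ξ : EuclideanSpace ℝ (Fin n)) (c : ℝ) :
    Convex ℝ (cutSection Ω v ξ c) := by
  intro x hx y hy s t hs ht hst
  refine ⟨hv.1 hx.1 hy.1 hs ht hst, (hv.2 hx.1 hy.1 hs ht hst).trans_lt ?_⟩
  rw [inner_add_right, inner_smul_right, inner_smul_right, smul_eq_mul, smul_eq_mul]
  have h1 := hx.2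
  have h2 := hy.2
  rcases hs.eq_or_lt with rfl | hs
  · obtain rfl : t = 1 := by linarith
    linarith
  · have h3 := mul_lt_mul_of_pos_left h1 hs
    have h4 := mul_le_mul_of_nonneg_left h2.le ht
    have h5 : s * c + t * c = c := by rw [← add_mul, hst, one_mul]
    linarith

/-- The cone with vertex at `a` over the section has slopes in the gradient image: if `m` is the
height of the cutting plane above `v` at `a`, then `ξ + m q` is a subgradient for each `q` in the
polar of the section at `a`. -/
theorem image_polarAt_subset_gradientImage (hΩ : IsOpen Ω) (hv : ConvexOn ℝ Ω v)
    {ξ a : EuclideanSpace ℝ (Fin n)} {c : ℝ} (hK : IsCompact (closure (cutSection Ω v ξ c)))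
    (hKΩ : closure (cutSection Ω v ξ c) ⊆ Ω) (ha : a ∈ cutSection Ω v ξ c) :
    (fun q => ξ + (inner ℝ ξ a + c - v a) • q) '' polarAt (cutSection Ω v ξ c) a ⊆
      gradientImage Ω v (cutSection Ω v ξ c) := by
  rintro _ ⟨q, hq, rfl⟩
  have hvc := hv.continuousOn hΩ
  set Z := cutSection Ω v ξ c
  set m := inner ℝ ξ a + c - v a
  set η := ξ + m • q with hη
  have hm : 0 < m := by have := ha.2; simp only [m]; linarith
  set w : EuclideanSpace ℝ (Fin n) → ℝ := fun x => v x - inner ℝ η x with hw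
  have hq' : ∀ x ∈ closure Z, inner ℝ q (x - a) ≤ 1 := fun x hx =>
    closure_minimal (t := {x | inner ℝ q (x - a) ≤ 1}) hq
      (isClosed_le (by fun_prop) continuous_const) hx
  obtain ⟨x₁, hx₁, hmin⟩ := hK.exists_isMinOn ⟨a, subset_closure ha⟩
    ((hvc.mono hKΩ).sub (Continuous.continuousOn (f := fun x => inner ℝ η x) (by fun_prop)))
  have hmin' : ∀ y ∈ closure Z, w x₁ ≤ w y := fun y hy => hmin hy
  -- a minimum on the boundary of the section is also attained at `a`
  obtain ⟨x, hxZ, hx⟩ : ∃ x ∈ Z, ∀ y ∈ closure Z, w x ≤ w y := by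
    by_cases h : x₁ ∈ Z
    · exact ⟨x₁, h, hmin'⟩
    · refine ⟨a, ha, fun y hy => le_trans ?_ (hmin' y hy)⟩
      have h1 : inner ℝ ξ x₁ + c ≤ v x₁ := by
        by_contra! hlt
        exact h ⟨hKΩ hx₁, hlt⟩
      have h2 := mul_le_mul_of_nonneg_left (hq' x₁ hx₁) hm.le
      simp only [hw, hη, inner_add_left, inner_smul_left, conj_trivial]
      rw [inner_sub_right] at h2
      have h3 : v a = inner ℝ ξ a + c - m := by simp only [m]; ring
      rw [h3]
      linarith
  have hconv : ConvexOn ℝ Ω w := by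
    refine hv.sub ⟨hv.1, fun y _ z _ s t _ _ _ => ?_⟩
    rw [inner_add_right, inner_smul_right, inner_smul_right, smul_eq_mul, smul_eq_mul]
  have hloc : IsLocalMinOn w Ω x :=
    Filter.Eventually.filter_mono nhdsWithin_le_nhds <| Filter.mem_of_superset
      ((isOpen_cutSection hΩ hvc ξ c).mem_nhds hxZ) fun y hy => hx y (subset_closure hy)
  have hglob := IsMinOn.of_isLocalMinOn_of_convexOn hxZ.1 hloc hconv
  refine mem_biUnion (x := x) ⟨hxZ, hxZ.1⟩ fun y hy => ?_
  have : w x ≤ w y := hglob hy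
  simp only [hw] at this
  rw [inner_sub_right]
  linarith

/-- Subgradients at points of the section shrunk by a factor two towards `z` have slopes controlled
by the maximal height `M` of the cutting plane above `v` and the polar of the section at `z`. -/
theorem gradientImage_half_subset (hv : ConvexOn ℝ Ω v) {ξ z : EuclideanSpace ℝ (Fin n)}
    {c M : ℝ} (hM : 0 < M) (hz : z ∈ cutSection Ω v ξ c)
    (hMle : ∀ y ∈ cutSection Ω v ξ c, inner ℝ ξ y + c - v y ≤ M) :
    gradientImage Ω v ((fun x => (2⁻¹ : ℝ) • (z + x)) '' cutSection Ω v ξ c) ⊆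
      (fun q => ξ + (2 * M) • q) '' polarAt (cutSection Ω v ξ c) z := by
  have hconv := convex_cutSection hv ξ c
  intro η hη
  simp only [gradientImage, mem_iUnion, mem_inter_iff, exists_prop] at hη
  obtain ⟨_, ⟨⟨x, hx, rfl⟩, -⟩, hsub⟩ := hη
  have hmid : ∀ x' ∈ cutSection Ω v ξ c, (2⁻¹ : ℝ) • (x' + x) ∈ cutSection Ω v ξ c := by
    intro x' hx'
    rw [smul_add]
    exact hconv hx' hx (by norm_num) (by norm_num) (by norm_num)
  refine ⟨(2 * M)⁻¹ • (η - ξ), fun x' hx' => ?_, ?_⟩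
  · have h1 := hsub _ (hmid x' hx').1
    have h2 := (hmid x' hx').2
    have h3 := hMle _ (hmid z hz)
    have e1 : (2⁻¹ : ℝ) • (x' + x) - (2⁻¹ : ℝ) • (z + x) = (2⁻¹ : ℝ) • (x' - z) := by module
    have e2 : (2⁻¹ : ℝ) • (x' + x) = (2⁻¹ : ℝ) • (z + x) + (2⁻¹ : ℝ) • (x' - z) := by module
    rw [e1, inner_smul_right] at h1
    have h4 : inner ℝ ξ ((2⁻¹ : ℝ) • (x' + x)) =
        inner ℝ ξ ((2⁻¹ : ℝ) • (z + x)) + 2⁻¹ * inner ℝ ξ (x' - z) := by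
      rw [e2, inner_add_right, inner_smul_right ξ (x' - z)]
    rw [inner_smul_left, conj_trivial, inner_sub_left, inv_mul_le_one₀ (by positivity)]
    linarith
  · simp only
    rw [smul_inv_smul₀ (by positivity), add_sub_cancel]

/-- If the section is cut by a plane close enough to the zero level, it stays in any prescribed
neighbourhood of the zero set, for lack of small values of `v` on the boundary of that
neighbourhood. -/
theorem exists_closure_cutSection_subset (hΩ : IsOpen Ω) (hv : ConvexOn ℝ Ω v)
    (hv0 : ∀ x ∈ Ω, 0 ≤ v x) (hS : IsCompact {x ∈ Ω | v x = 0})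
    {W : Set (EuclideanSpace ℝ (Fin n))} (hW : IsOpen W) (hSW : {x ∈ Ω | v x = 0} ⊆ W)
    {a e : EuclideanSpace ℝ (Fin n)} (ha : a ∈ {x ∈ Ω | v x = 0}) {c : ℝ}
    (hac : 0 < inner ℝ e a + c) :
    ∃ ε > 0, IsCompact (closure (cutSection Ω v (ε • e) (ε * c))) ∧
      closure (cutSection Ω v (ε • e) (ε * c)) ⊆ Ω ∩ W := by
  have hvc := hv.continuousOn hΩ
  obtain ⟨V, hVo, hSV, hVsub, hVc⟩ := exists_open_between_and_isCompact_closure hS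
    (hΩ.inter hW) (subset_inter (fun x hx => hx.1) hSW)
  have hfr : IsCompact (frontier V) := hVc.of_isClosed_subset isClosed_frontier
    frontier_subset_closure
  have hfrΩ : frontier V ⊆ Ω := fun x hx => (hVsub (frontier_subset_closure hx)).1
  obtain ⟨m, hm, hmv⟩ : ∃ m > 0, ∀ x ∈ frontier V, m ≤ v x := by
    rcases (frontier V).eq_empty_or_nonempty with h | h
    · exact ⟨1, one_pos, by simp [h]⟩
    obtain ⟨x, hx, hmin⟩ := hfr.exists_isMinOn h (hvc.mono hfrΩ)
    refine ⟨v x, lt_of_le_of_ne (hv0 x (hfrΩ hx)) fun h0 => ?_, fun y hy => hmin hy⟩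
    rw [hVo.frontier_eq] at hx
    exact hx.2 (hSV ⟨(hVsub hx.1).1, h0.symm⟩)
  obtain ⟨B, hB⟩ := (hVc.image (f := fun x => inner ℝ e x + c) (by fun_prop)).bddAbove
  have hB' : ∀ x ∈ closure V, inner ℝ e x + c ≤ B := fun x hx => hB ⟨x, hx, rfl⟩
  have hBpos : 0 < B := hac.trans_le (hB' a (subset_closure (hSV ha)))
  have hε : 0 < m / B := div_pos hm hBpos
  have hl : ∀ x, inner ℝ ((m / B) • e) x + m / B * c = m / B * (inner ℝ e x + c) := by
    intro x
    rw [inner_smul_left, conj_trivial]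
    ring
  set Z := cutSection Ω v ((m / B) • e) (m / B * c) with hZ
  have haZ : a ∈ Z := ⟨ha.1, by rw [ha.2, hl]; positivity⟩
  have hsub : Z ⊆ V := by
    have hdisj : ∀ x ∈ Z, x ∉ frontier V := by
      intro x hx hxV
      have h1 := hx.2
      rw [hl] at h1
      have h2 := mul_le_mul_of_nonneg_left (hB' x (frontier_subset_closure hxV)) hε.le
      rw [div_mul_cancel₀ _ hBpos.ne'] at h2
      linarith [hmv x hxV]
    refine (convex_cutSection hv _ _).isPreconnected.subset_left_of_subset_union hVo
      isClosed_closure.isOpen_compl (disjoint_compl_right.mono_left subset_closure)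
      (fun x hx => ?_) ⟨a, haZ, hSV ha⟩
    by_contra! h
    simp only [mem_union, mem_compl_iff, not_or, not_not] at h
    exact hdisj x hx (hVo.frontier_eq ▸ ⟨h.2, h.1⟩)
  exact ⟨m / B, hε, hVc.of_isClosed_subset isClosed_closure (closure_mono hsub),
    (closure_mono hsub).trans hVsub⟩

end Section

/-! ### Doubling for the Monge–Ampère measure -/

section Doubling

variable {n : ℕ} {Ω : Set (EuclideanSpace ℝ (Fin n))} {v : EuclideanSpace ℝ (Fin n) → ℝ}

theorem measurableSet_image_half (z : EuclideanSpace ℝ (Fin n))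
    {A : Set (EuclideanSpace ℝ (Fin n))} (hA : MeasurableSet A) :
    MeasurableSet ((fun x => (2⁻¹ : ℝ) • (z + x)) '' A) :=
  ((measurableEmbedding_const_smul₀ (by norm_num : (2⁻¹ : ℝ) ≠ 0)).comp
    (measurableEmbedding_addLeft z)).measurableSet_image.mpr hA

theorem lintegral_image_half (z : EuclideanSpace ℝ (Fin n)) {A : Set (EuclideanSpace ℝ (Fin n))}
    (hA : MeasurableSet A) (f : EuclideanSpace ℝ (Fin n) → ENNReal) :
    ∫⁻ x in (fun x => (2⁻¹ : ℝ) • (z + x)) '' A, f x =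
      ENNReal.ofReal ((2⁻¹ : ℝ) ^ n) * ∫⁻ x in A, f ((2⁻¹ : ℝ) • (z + x)) := by
  have hinj : Function.Injective fun x : EuclideanSpace ℝ (Fin n) => (2⁻¹ : ℝ) • (z + x) :=
    fun x y h => by simpa using h
  have hderiv : ∀ x ∈ A, HasFDerivWithinAt (fun x => (2⁻¹ : ℝ) • (z + x))
      ((2⁻¹ : ℝ) • ContinuousLinearMap.id ℝ (EuclideanSpace ℝ (Fin n))) A x := fun x _ =>
    (((hasFDerivAt_id x).const_add z).const_smul (2⁻¹ : ℝ)).hasFDerivWithinAt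
  rw [lintegral_image_eq_lintegral_abs_det_fderiv_mul volume hA hderiv hinj.injOn,
    lintegral_const_mul']
  · congr 2
    simp [ContinuousLinearMap.det, LinearMap.det_smul]
  · exact ENNReal.ofReal_ne_top

/-- Since the zero set is null for `μ_v`, the equation can be solved for `μ_v`, with density
`g v^{p-1}`. -/
theorem IsAlexandrovSolution.mongeAmpereMeasure_eq {p : ℝ}
    {g : EuclideanSpace ℝ (Fin n) → ℝ} {hΩ : IsOpen Ω} {hv : ConvexOn ℝ Ω v}
    (hsol : IsAlexandrovSolution hΩ hv p g) (hv0 : ∀ x ∈ Ω, 0 ≤ v x)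
    (hSμ : mongeAmpereMeasure hΩ hv {x ∈ Ω | v x = 0} = 0) :
    mongeAmpereMeasure hΩ hv = ((volume.restrict Ω).withDensity
      (fun x => ENNReal.ofReal (g x))).withDensity
        (fun x => (ENNReal.ofReal (v x ^ (1 - p)))⁻¹) := by
  have hΩae : ∀ᵐ x ∂(mongeAmpereMeasure hΩ hv), x ∈ Ω := by
    rw [ae_iff]
    change mongeAmpereMeasure hΩ hv Ωᶜ = 0
    rw [mongeAmpereMeasure_apply hΩ hv hΩ.measurableSet.compl]
    simp [gradientImage]
  have hvm : AEMeasurable v (mongeAmpereMeasure hΩ hv) := by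
    rw [← Measure.restrict_eq_self_of_ae_mem hΩae]
    exact (hv.continuousOn hΩ).aemeasurable hΩ.measurableSet
  rw [← hsol, withDensity_inv_same₀ (hvm.pow_const _).ennreal_ofReal _
    (.of_forall fun _ => ENNReal.ofReal_ne_top)]
  filter_upwards [hΩae, measure_eq_zero_iff_ae_notMem.mp hSμ] with x hx hxS
  have hpos : 0 < v x := lt_of_le_of_ne (hv0 x hx) fun h => hxS ⟨hx, h.symm⟩
  exact (ENNReal.ofReal_pos.mpr (Real.rpow_pos_of_pos hpos _)).ne'

/-- Shrinking towards a zero `z` of `v` decreases `v`, so it increases the density `v^{p-1}`;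
hence `μ_v` is doubling for the dilations centred at `z`. -/
theorem IsAlexandrovSolution.mongeAmpereMeasure_le_half {τ₁ τ₂ p : ℝ} (hτ₁ : 0 < τ₁) (hp : p < 1)
    {g : EuclideanSpace ℝ (Fin n) → ℝ} {hΩ : IsOpen Ω} {hv : ConvexOn ℝ Ω v}
    (hg : ∀ x ∈ Ω, τ₁ < g x ∧ g x < τ₂)
    (hsol : IsAlexandrovSolution hΩ hv p g) (hv0 : ∀ x ∈ Ω, 0 ≤ v x)
    (hSμ : mongeAmpereMeasure hΩ hv {x ∈ Ω | v x = 0} = 0)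
    {z : EuclideanSpace ℝ (Fin n)} (hz : z ∈ Ω) (hvz : v z = 0)
    {Z : Set (EuclideanSpace ℝ (Fin n))} (hZ : MeasurableSet Z) (hZΩ : Z ⊆ Ω) :
    mongeAmpereMeasure hΩ hv Z ≤ ENNReal.ofReal (τ₂ / τ₁ * 2 ^ n) *
      mongeAmpereMeasure hΩ hv ((fun x => (2⁻¹ : ℝ) • (z + x)) '' Z) := by
  set φ := fun x : EuclideanSpace ℝ (Fin n) => (2⁻¹ : ℝ) • (z + x) with hφ
  set F : EuclideanSpace ℝ (Fin n) → ENNReal := fun x => (ENNReal.ofReal (v x ^ (1 - p)))⁻¹ with hF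
  have hmid : ∀ x ∈ Ω, φ x ∈ Ω ∧ v (φ x) ≤ v x := by
    intro x hx
    simp only [hφ, smul_add]
    refine ⟨hv.1 hz hx (by norm_num) (by norm_num) (by norm_num), ?_⟩
    have h := hv.2 hz hx (show (0 : ℝ) ≤ 2⁻¹ by norm_num) (show (0 : ℝ) ≤ 2⁻¹ by norm_num)
      (by norm_num)
    rw [hvz, smul_eq_mul, smul_eq_mul] at h
    linarith [hv0 x hx]
  have hφZ : MeasurableSet (φ '' Z) := measurableSet_image_half z hZ
  have hφZΩ : φ '' Z ⊆ Ω := by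
    rintro _ ⟨x, hx, rfl⟩
    exact (hmid x (hZΩ hx)).1
  have hup : (volume.restrict Ω).withDensity (fun x => ENNReal.ofReal (g x)) ≤
      ENNReal.ofReal τ₂ • volume.restrict Ω := by
    rw [← withDensity_const]
    refine withDensity_mono ((ae_restrict_mem hΩ.measurableSet).mono fun x hx => ?_)
    exact ENNReal.ofReal_le_ofReal (hg x hx).2.le
  have hlow : ENNReal.ofReal τ₁ • volume.restrict Ω ≤
      (volume.restrict Ω).withDensity (fun x => ENNReal.ofReal (g x)) := by
    rw [← withDensity_const]
    refine withDensity_mono ((ae_restrict_mem hΩ.measurableSet).mono fun x hx => ?_)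
    exact ENNReal.ofReal_le_ofReal (hg x hx).1.le
  have hτ₂ : 0 < τ₂ := by linarith [hg z hz]
  rw [hsol.mongeAmpereMeasure_eq hv0 hSμ, withDensity_apply _ hZ, withDensity_apply _ hφZ]
  calc _ ≤ ∫⁻ x in Z, F x ∂(ENNReal.ofReal τ₂ • volume.restrict Ω) :=
        lintegral_mono' (Measure.restrict_mono le_rfl hup) le_rfl
    _ = ENNReal.ofReal τ₂ * ∫⁻ x in Z, F x := by
        rw [Measure.restrict_smul, lintegral_smul_measure, smul_eq_mul,
          Measure.restrict_restrict_of_subset hZΩ]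
    _ ≤ ENNReal.ofReal τ₂ * ∫⁻ x in Z, F (φ x) := by
        refine mul_le_mul_right (setLIntegral_mono' hZ fun x hx => ?_) _
        have h := hmid x (hZΩ hx)
        exact ENNReal.inv_le_inv.mpr (ENNReal.ofReal_le_ofReal
          (Real.rpow_le_rpow (hv0 _ h.1) h.2 (by linarith)))
    _ = ENNReal.ofReal (τ₂ / τ₁ * 2 ^ n) * (ENNReal.ofReal τ₁ * ∫⁻ x in φ '' Z, F x) := by
        rw [lintegral_image_half z hZ, ← mul_assoc, ← mul_assoc,
          ← ENNReal.ofReal_mul (by positivity), ← ENNReal.ofReal_mul (by positivity)]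
        congr 2
        rw [inv_pow]
        field_simp
    _ = ENNReal.ofReal (τ₂ / τ₁ * 2 ^ n) *
          ∫⁻ x in φ '' Z, F x ∂(ENNReal.ofReal τ₁ • volume.restrict Ω) := by
        rw [Measure.restrict_smul, lintegral_smul_measure, smul_eq_mul,
          Measure.restrict_restrict_of_subset hφZΩ]
    _ ≤ _ := mul_le_mul_right
        (lintegral_mono' (Measure.restrict_mono le_rfl hlow) le_rfl) _

end Doubling

/-! ### The zero set is a point -/

theorem mainTheorem5 (n : ℕ) (hn : 2 ≤ n) (τ₁ τ₂ p : ℝ) (hτ₁ : 0 < τ₁) (hτ : τ₁ < τ₂) (hp : p < 1)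
    (Ω : Set (EuclideanSpace ℝ (Fin n))) (hΩ : IsOpen Ω)
    (g v : EuclideanSpace ℝ (Fin n) → ℝ)
    (hgm : AEMeasurable g (volume.restrict Ω)) (hg : ∀ x ∈ Ω, τ₁ < g x ∧ g x < τ₂)
    (hv : ConvexOn ℝ Ω v) (hv0 : ∀ x ∈ Ω, 0 ≤ v x)
    (hsol : IsAlexandrovSolution hΩ hv p g)
    (hSne : {x ∈ Ω | v x = 0}.Nonempty) (hScpt : IsCompact {x ∈ Ω | v x = 0})
    (hSμ : mongeAmpereMeasure hΩ hv {x ∈ Ω | v x = 0} = 0)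
    (hstrict : LocallyStrictConvexOn (Ω \ {x ∈ Ω | v x = 0}) v) :
    ∃ x₀, {x ∈ Ω | v x = 0} = {x₀} := by
  set S := {x ∈ Ω | v x = 0} with hS
  rcases hSne.exists_eq_singleton_or_nontrivial with h | ⟨u, hu, b, hb, hub⟩
  · exact h
  exfalso
  have hSconv : Convex ℝ S := by
    intro x hx y hy s t hs ht hst
    have hxy := hv.1 hx.1 hy.1 hs ht hst
    refine ⟨hxy, le_antisymm ?_ (hv0 _ hxy)⟩
    have h := hv.2 hx.1 hy.1 hs ht hst
    rwa [hx.2, hy.2, smul_zero, smul_zero, add_zero] at h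
  -- `a` is extreme for `S` in the direction `e`, and the cutting planes `ε ⟪e, x - b⟫` vanish at `b`
  set e := u - b with he
  obtain ⟨a, ha, hamax⟩ := hScpt.exists_isMaxOn hSne
    (Continuous.continuousOn (f := fun x => inner ℝ e x) (by fun_prop))
  have hamax' : ∀ x ∈ S, inner ℝ e x ≤ inner ℝ e a := fun x hx => hamax hx
  set d := inner ℝ e (a - b) with hd
  have hdpos : 0 < d := by
    have h1 : 0 < inner ℝ e e := real_inner_self_pos.mpr (sub_ne_zero.mpr hub)
    have h2 : inner ℝ e e = inner ℝ e u - inner ℝ e b := by rw [← inner_sub_right]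
    rw [hd, inner_sub_right]
    linarith [hamax' u hu]
  -- `τ₂ / τ₁ * 64 ^ n` collects the doubling constant `2 ^ n τ₂ / τ₁` and the factors `8 ^ n`
  -- and `4 ^ n` from the comparison of polars and from the slopes over the shrunk section
  obtain ⟨N, hN⟩ := exists_nat_gt (τ₂ / τ₁ * 64 ^ n)
  have hτ₂ : 0 < τ₂ := hτ₁.trans hτ
  have hNpos : (0 : ℝ) < N := lt_trans (by positivity) hN
  have hNnat : 0 < N := by exact_mod_cast hNpos
  obtain ⟨ε, hε, hZc, hZsub⟩ := exists_closure_cutSection_subset hΩ hv hv0 hScpt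
    (W := {x | inner ℝ e (x - a) < d / (4 * N)}) (isOpen_lt (by fun_prop) continuous_const)
    (fun x hx => by
      have h1 := hamax' x hx
      have h2 : 0 < d / (4 * N) := by positivity
      rw [mem_ofPred_eq, inner_sub_right]
      linarith) (a := a) (e := e) ha (c := -inner ℝ e b) (by
      rw [← sub_eq_add_neg, ← inner_sub_right]; exact hdpos)
  set Z := cutSection Ω v (ε • e) (ε * -inner ℝ e b) with hZ
  have hl : ∀ x, inner ℝ (ε • e) x + ε * -inner ℝ e b = ε * inner ℝ e (x - b) := by
    intro x
    rw [inner_smul_left, conj_trivial, inner_sub_right]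
    ring
  have hZo : IsOpen Z := isOpen_cutSection hΩ (hv.continuousOn hΩ) _ _
  have hcut : ∀ x ∈ Z, inner ℝ e (x - a) ≤ d / (4 * N) := fun x hx =>
    (hZsub (subset_closure hx)).2.le
  have hseg : ∀ t ∈ Ico (0 : ℝ) 1, a + t • (b - a) ∈ Z := by
    intro t ht
    have h1 : a + t • (b - a) ∈ S := hSconv.add_smul_sub_mem ha hb ⟨ht.1, ht.2.le⟩
    refine ⟨h1.1, ?_⟩
    have e1 : a + t • (b - a) - b = (1 - t) • (a - b) := by module
    rw [h1.2, hl, e1, inner_smul_right]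
    have := sub_pos.mpr ht.2
    positivity
  have haZ : a ∈ Z := by simpa using hseg 0 (by simp)
  set z := (2⁻¹ : ℝ) • (a + b) with hz
  have hzeq : a + (2⁻¹ : ℝ) • (b - a) = z := by rw [hz]; module
  have hzS : z ∈ S := hzeq ▸ hSconv.add_smul_sub_mem ha hb (by constructor <;> norm_num)
  have hzZ : z ∈ Z := hzeq ▸ hseg _ (by constructor <;> norm_num)
  -- the height of the cutting plane above `v` is `ε d` at `a`, and nowhere more than `2 ε d`
  have hheight : inner ℝ (ε • e) a + ε * -inner ℝ e b - v a = ε * d := by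
    rw [hl, ha.2, sub_zero]
  have hM : ∀ y ∈ Z, inner ℝ (ε • e) y + ε * -inner ℝ e b - v y ≤ 2 * (ε * d) := by
    intro y hy
    have h1 : inner ℝ e (y - b) = inner ℝ e (y - a) + d := by
      rw [hd, ← inner_add_right, sub_add_sub_cancel]
    have h2 : d / (4 * N) ≤ d := by
      have : (1 : ℝ) ≤ N := by exact_mod_cast hNnat
      exact div_le_self hdpos.le (by linarith)
    have h3 : ε * inner ℝ e (y - b) ≤ ε * (2 * d) :=
      mul_le_mul_of_nonneg_left (by linarith [hcut y hy]) hε.le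
    rw [hl]
    linarith [hv0 y hy.1]
  have hεd : 0 < ε * d := mul_pos hε hdpos
  have hlower : ENNReal.ofReal ((ε * d) ^ n) * volume (polarAt Z a) ≤
      mongeAmpereMeasure hΩ hv Z := by
    have h := measure_mono (μ := volume) (image_polarAt_subset_gradientImage hΩ hv hZc
      (hZsub.trans inter_subset_left) haZ)
    rwa [hheight, addHaar_image_add_smul volume _ hεd.le, finrank_euclideanSpace_fin,
      ← mongeAmpereMeasure_apply hΩ hv hZo.measurableSet] at h
  have hupper : mongeAmpereMeasure hΩ hv ((fun x => (2⁻¹ : ℝ) • (z + x)) '' Z) ≤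
      ENNReal.ofReal ((4 * (ε * d)) ^ n) * volume (polarAt Z z) := by
    have h := measure_mono (μ := volume) (gradientImage_half_subset hv
      (show 0 < 2 * (ε * d) by positivity) hzZ hM)
    rw [addHaar_image_add_smul volume _ (by positivity), finrank_euclideanSpace_fin,
      ← mongeAmpereMeasure_apply hΩ hv (measurableSet_image_half z hZo.measurableSet),
      show 2 * (2 * (ε * d)) = 4 * (ε * d) by ring] at h
    exact h
  have hdouble := hsol.mongeAmpereMeasure_le_half hτ₁ hp hg hv0 hSμ hzS.1 hzS.2
    hZo.measurableSet fun x hx => hx.1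
  have hpolar := natCast_mul_addHaar_polarAt_le volume hNnat hZo hdpos hseg hcut
  rw [finrank_euclideanSpace_fin, ← hz] at hpolar
  have hLtop : volume (polarAt Z z) ≠ ⊤ := (isBounded_polarAt hZo hzZ).measure_lt_top.ne
  have hLpos : 0 < (volume (polarAt Z z)).toReal := ENNReal.toReal_pos
    (Measure.measure_pos_of_mem_nhds volume
      (polarAt_mem_nhds_zero (hZc.isBounded.subset subset_closure) z)).ne'
    hLtop
  have hall := (mul_le_mul_right hpolar _).trans
    (hlower.trans (hdouble.trans (mul_le_mul_right hupper _)))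
  rw [← ENNReal.ofReal_toReal hLtop] at hall
  set L := (volume (polarAt Z z)).toReal
  rw [← ENNReal.ofReal_natCast N, ← ENNReal.ofReal_mul (by positivity),
    ← ENNReal.ofReal_mul (by positivity), ← ENNReal.ofReal_mul (by positivity),
    ← ENNReal.ofReal_mul (by positivity), ← ENNReal.ofReal_mul (by positivity),
    ENNReal.ofReal_le_ofReal_iff (by positivity)] at hall
  have e1 : (ε * d) ^ n * (N * ((1 / 8) ^ n * L)) = (ε * d / 8) ^ n * L * N := by
    rw [div_pow, div_pow, one_pow]; field_simp
  have e2 : τ₂ / τ₁ * 2 ^ n * ((4 * (ε * d)) ^ n * L) =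
      (ε * d / 8) ^ n * L * (τ₂ / τ₁ * 64 ^ n) := by
    rw [show (64 : ℝ) ^ n = 2 ^ n * 4 ^ n * 8 ^ n by rw [← mul_pow, ← mul_pow]; norm_num,
      div_pow, mul_pow 4]
    field_simp
  rw [e1, e2] at hall
  exact absurd (le_of_mul_le_mul_left hall (by positivity)) (not_le.mpr hN)
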